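/- Let $F$ be a field (of any characteristic) and let $(V,\omega)$ be a finite-dimensional symplectic vector space over $F$, i.e. $\omega$ is an alternating ($\omega(v,v)=0$ for all $v$), non-degenerate bilinear form on $V$; write $\dim_F V=2n$ and let $E$ be the identity map. For $M\in\operatorname{End}(V)$ let $M^{*\omega}=(\omega^\flat)^{-1}M^*\omega^\flat$ be its symplectic adjoint, where $\omega^\flat:V\to V^*$, $v\mapsto\omega(\cdot,v)$, so that $\omega(Mv,w)=\omega(v,M^{*\omega}w)$ for all $v,w\in V$. For an endomorphism $A$ of a symplectic vector space $(V,\omega)$ such that $(v,w)\mapsto\omega(v,Aw)$ is alternating, put $$\psi_A(t)=\operatorname{Pf}\bigl(\omega(v_i,(A-tE)v_j)\bigr)_{1\le i,j\le 2n},$$ where $(v_1,\dots,v_{2n})=(e_1,f_1,\dots,e_n,f_n)$ is a symplectic basis ($\omega(e_i,e_j)=\omega(f_i,f_j)=0$, $\omega(e_i,f_j)=\delta_{ij}$) and $\operatorname{Pf}$ is the Pfaffian; this does not depend on the choice of the symplectic basis. The symplectic characteristic polynomial of $M$ is $$\chi^{\omega}_M(s,t)=\psi_{(M-sE)(M^{*\omega}-sE)}(t),$$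 where $(M-sE)(M^{*\omega}-sE)$ is regarded as an endomorphism of the symplectic vector space $V\otimes_F F(s)$ over the field $F(s)$ of rational functions. Let $M\in\operatorname{End}(V)$ be symplectically normal, i.e. $MM^{*\omega}=M^{*\omega}M$, and let $\lambda,\mu\in F$. Then $$\chi^{\omega}_M\bigl(s,(\lambda-s)(\mu-s)\bigr)=0 \text{ in } F(s)\quad\Longleftrightarrow\quad \ker(M-\lambda E)\cap\ker(M^{*\omega}-\mu E)\neq\{0\}.$$ -/

import Mathlib

open scoped TensorProduct

namespace SymplecticCharPoly

/-- The Pfaffian of a square matrix of size `2n`. The index set `Fin n × Fin 2` is ordered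
lexicographically, i.e. as `(0,0) < (0,1) < (1,0) < (1,1) < ⋯`, so that it is the ordered set
`1 < 2 < ⋯ < 2n`. The sum runs over the perfect matchings
`{σ(0,0), σ(0,1)}, …, {σ(n-1,0), σ(n-1,1)}` of the index set, each of them written in its unique
standard form `σ(i,0) < σ(i,1)` and `σ(0,0) < σ(1,0) < ⋯ < σ(n-1,0)`; its term is
`sign σ * ∏ i, A (σ(i,0)) (σ(i,1))`. -/
def pfaffian {R : Type*} [CommRing R] {n : ℕ}
    (A : Matrix (Fin n × Fin 2) (Fin n × Fin 2) R) : R :=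
  ∑ σ : Equiv.Perm (Fin n × Fin 2) with
      (∀ i, toLex (σ (i, 0)) < toLex (σ (i, 1))) ∧
        ∀ i j, i < j → toLex (σ (i, 0)) < toLex (σ (j, 0)),
    ((Equiv.Perm.sign σ : ℤ) : R) * ∏ i, A (σ (i, 0)) (σ (i, 1))

section Field

variable {K : Type*} [Field K] {V : Type*} [AddCommGroup V] [Module K V]

/-- A bilinear form is symplectic if it is alternating and non-degenerate. -/
structure IsSymplectic (ω : LinearMap.BilinForm K V) : Prop where
  alt : ω.IsAlt
  nondegenerate : ω.Nondegenerate

/-- A symplectic basis `e₁, f₁, …, eₙ, fₙ` of `(V, ω)`, where `eᵢ` has the index `(i, 0)` and `fᵢ`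
has the index `(i, 1)`. -/
structure SymplecticBasis (ω : LinearMap.BilinForm K V) where
  n : ℕ
  basis : Module.Basis (Fin n × Fin 2) K V
  apply_e_e : ∀ i j, ω (basis (i, 0)) (basis (j, 0)) = 0
  apply_f_f : ∀ i j, ω (basis (i, 1)) (basis (j, 1)) = 0
  apply_e_f : ∀ i j, ω (basis (i, 0)) (basis (j, 1)) = if i = j then 1 else 0

theorem exists_symplectic_family (m : ℕ) : ∀ {V : Type*} [AddCommGroup V] [Module K V]
    [FiniteDimensional K V] (ω : LinearMap.BilinForm K V), IsSymplectic ω →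
    Module.finrank K V = m →
    ∃ (n : ℕ) (v : Fin n × Fin 2 → V), Module.finrank K V = 2 * n ∧
      (∀ i j, ω (v (i, 0)) (v (j, 0)) = 0) ∧ (∀ i j, ω (v (i, 1)) (v (j, 1)) = 0) ∧
      ∀ i j, ω (v (i, 0)) (v (j, 1)) = if i = j then 1 else 0 := by
  induction m using Nat.strong_induction_on with
  | _ m ih =>
  intro V _ _ _ ω hω hm
  rcases subsingleton_or_nontrivial V with hV | hV
  · refine ⟨0, fun _ => 0, ?_, fun i => i.elim0, fun i => i.elim0, fun i => i.elim0⟩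
    simpa using Module.finrank_zero_of_subsingleton (R := K) (M := V)
  obtain ⟨e, he⟩ := exists_ne (0 : V)
  obtain ⟨f', hf'⟩ : ∃ f', ω e f' ≠ 0 := by
    by_contra! h
    exact he (hω.nondegenerate.1 e h)
  obtain ⟨f, hef⟩ : ∃ f, ω e f = 1 := ⟨(ω e f')⁻¹ • f', by simp [hf']⟩
  have hee := hω.alt e
  have hff := hω.alt f
  have hfe : ω f e = -1 := by rw [← hω.alt.neg_eq, hef]
  have hli : LinearIndependent K ![e, f] := by
    rw [LinearIndependent.pair_iff]
    intro s t h
    have h1 := congrArg (ω e) h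
    have h2 := congrArg (ω f) h
    simp [hee, hef] at h1
    simp [hff, hfe] at h2
    exact ⟨h2, h1⟩
  set U : Submodule K V := Submodule.span K (Set.range ![e, f]) with hU
  have hUr : Module.finrank K U = 2 := by
    simpa using finrank_span_eq_card hli
  have heU : e ∈ U := Submodule.subset_span ⟨0, rfl⟩
  have hfU : f ∈ U := Submodule.subset_span ⟨1, rfl⟩
  set W := ω.orthogonal U with hW
  have hWr : Module.finrank K W = Module.finrank K V - 2 := by
    rw [hW, LinearMap.BilinForm.finrank_orthogonal hω.nondegenerate, hUr]
  have hV2 : 2 ≤ Module.finrank K V := hUr ▸ Submodule.finrank_le U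
  have hrefl : ω.IsRefl := hω.alt.isRefl
  have hdisj : Disjoint W (ω.orthogonal W) := by
    rw [hW, LinearMap.BilinForm.orthogonal_orthogonal hω.nondegenerate hrefl,
      Submodule.disjoint_def]
    intro x hx hxU
    rw [hU, Matrix.range_cons, Matrix.range_cons, Matrix.range_empty, Set.union_empty,
      Set.singleton_union, Submodule.mem_span_pair] at hxU
    obtain ⟨a, b, rfl⟩ := hxU
    have h1 := hx e heU
    have h2 := hx f hfU
    simp [hee, hef] at h1
    simp [hff, hfe] at h2
    simp [h1, h2]
  have hres : IsSymplectic (ω.restrict W) :=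
    ⟨fun x => hω.alt x, ω.nondegenerate_restrict_of_disjoint_orthogonal hrefl hdisj⟩
  obtain ⟨n, v, hn, h00, h11, h01⟩ :=
    ih (Module.finrank K W) (by omega) (ω.restrict W) hres rfl
  have hl : ∀ u ∈ U, ∀ w : W, ω u w = 0 := fun u hu w => w.2 u hu
  have hr : ∀ u ∈ U, ∀ w : W, ω w u = 0 := fun u hu w => hrefl _ _ (hl u hu w)
  refine ⟨n + 1, fun p => Fin.cases (if p.2 = 0 then e else f) (fun i => (v (i, p.2) : V)) p.1,
    by omega, ?_, ?_, ?_⟩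
  · intro i j
    cases i using Fin.cases <;> cases j using Fin.cases
    · simpa using hee
    · simpa using hl e heU _
    · simpa using hr e heU _
    · simpa using h00 _ _
  · intro i j
    cases i using Fin.cases <;> cases j using Fin.cases
    · simpa using hff
    · simpa using hl f hfU _
    · simpa using hr f hfU _
    · simpa using h11 _ _
  · intro i j
    cases i using Fin.cases <;> cases j using Fin.cases
    · simpa using hef
    · simpa [(Fin.succ_ne_zero _).symm] using hl e heU _
    · simpa [Fin.succ_ne_zero] using hr f hfU _
    · simpa using h01 _ _

theorem IsSymplectic.nonempty_symplecticBasis [FiniteDimensional K V]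
    {ω : LinearMap.BilinForm K V} (hω : IsSymplectic ω) : Nonempty (SymplecticBasis ω) := by
  obtain ⟨n, v, hn, h00, h11, h01⟩ := exists_symplectic_family _ ω hω rfl
  have h10 : ∀ i j, ω (v (i, 1)) (v (j, 0)) = if j = i then -1 else 0 := by
    intro i j
    rw [← hω.alt.neg_eq, h01]
    split_ifs <;> simp
  have hli : LinearIndependent K v := by
    rw [Fintype.linearIndependent_iff]
    intro g hg
    rintro ⟨i, k⟩
    have h0 := congrArg (ω (v (i, 0))) hg
    have h1 := congrArg (ω (v (i, 1))) hg
    simp [Fintype.sum_prod_type, h00, h01] at h0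
    simp [Fintype.sum_prod_type, h11, h10] at h1
    fin_cases k
    · exact h1
    · exact h0
  have hcard : Fintype.card (Fin n × Fin 2) = Module.finrank K V := by
    simp [hn, mul_comm]
  have hsp : ⊤ ≤ Submodule.span K (Set.range v) :=
    (hli.span_eq_top_of_card_eq_finrank' hcard).ge
  exact ⟨⟨n, Module.Basis.mk hli hsp, by simpa using h00, by simpa using h11, by simpa using h01⟩⟩

/-- The isomorphism `V → V*`, `v ↦ ω(·, v)`. -/
noncomputable def IsSymplectic.flat [FiniteDimensional K V] {ω : LinearMap.BilinForm K V}
    (hω : IsSymplectic ω) : V ≃ₗ[K] Module.Dual K V :=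
  LinearMap.BilinForm.toDual (LinearMap.BilinForm.flip ω) hω.nondegenerate.flip

/-- The symplectic adjoint `(ω♭)⁻¹ ∘ M* ∘ ω♭` of `M`, where `M*` is the dual map of `M`. -/
noncomputable def IsSymplectic.adjoint [FiniteDimensional K V] {ω : LinearMap.BilinForm K V}
    (hω : IsSymplectic ω) (M : Module.End K V) : Module.End K V :=
  hω.flat.symm.toLinearMap ∘ₗ Module.Dual.transpose (R := K) M ∘ₗ hω.flat.toLinearMap

/-- The polynomial `Pf (ω_{A - tE} (vᵢ, vⱼ))ᵢⱼ` in `t`, where `ω_B (v, w) = ω (v, B w)` and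
`(vᵢ) = (e₁, f₁, …, eₙ, fₙ)` is the symplectic basis `b`. -/
noncomputable def SymplecticBasis.psi {ω : LinearMap.BilinForm K V} (b : SymplecticBasis ω)
    (A : Module.End K V) : Polynomial K :=
  pfaffian (Matrix.of fun i j =>
    Polynomial.C (ω (b.basis i) (A (b.basis j))) -
      Polynomial.X * Polynomial.C (ω (b.basis i) (b.basis j)))

/-- The polynomial `ψ_A(t) = Pf_ω(ω_{A - tE})` of an endomorphism `A` of a symplectic vector space
such that `(v, w) ↦ ω (v, A w)` is alternating, computed in some symplectic basis (for such `A` it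
does not depend on that basis, because symplectic automorphisms have determinant `1`). -/
noncomputable def IsSymplectic.psi [FiniteDimensional K V] {ω : LinearMap.BilinForm K V}
    (hω : IsSymplectic ω) (A : Module.End K V) : Polynomial K :=
  (Classical.choice hω.nonempty_symplecticBasis).psi A

theorem IsSymplectic.baseChange [FiniteDimensional K V] {ω : LinearMap.BilinForm K V}
    (hω : IsSymplectic ω) (L : Type*) [Field L] [Algebra K L] :
    IsSymplectic (LinearMap.BilinForm.baseChange L ω) := by
  have hskew : ∀ x y, LinearMap.BilinForm.baseChange L ω x y
      = - LinearMap.BilinForm.baseChange L ω y x := by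
    intro x y
    induction x using TensorProduct.induction_on with
    | zero => simp
    | add x x' hx hx' => simp [hx, hx', add_comm]
    | tmul a v =>
      induction y using TensorProduct.induction_on with
      | zero => simp
      | add y y' hy hy' => simp [hy, hy', add_comm]
      | tmul c w =>
        rw [LinearMap.BilinForm.baseChange_tmul, LinearMap.BilinForm.baseChange_tmul,
          ← hω.alt.neg_eq w v, neg_smul, mul_comm]
  refine ⟨fun x => ?_, ?_⟩
  · induction x using TensorProduct.induction_on with
    | zero => simp
    | add x y hx hy =>
      rw [LinearMap.map_add₂, map_add, map_add, hx, hy, hskew x y]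
      simp
    | tmul a v => rw [LinearMap.BilinForm.baseChange_tmul, hω.alt v, zero_smul]
  · let b := Module.finBasis K V
    have h := (LinearMap.BilinForm.nondegenerate_iff_det_ne_zero b).1 hω.nondegenerate
    rw [LinearMap.BilinForm.nondegenerate_iff_det_ne_zero (b.baseChange L)]
    have hmat : LinearMap.BilinForm.toMatrix (b.baseChange L) (LinearMap.BilinForm.baseChange L ω)
        = (algebraMap K L).mapMatrix (LinearMap.BilinForm.toMatrix b ω) := by
      ext i j
      simp [LinearMap.BilinForm.toMatrix_apply, Module.Basis.baseChange_apply,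
        Algebra.smul_def]
    rw [hmat, ← RingHom.map_det]
    simpa using h

/-- The symplectic characteristic polynomial of `M`: the polynomial `ψ_{(M - sE)(M^{*ω} - sE)}(t)`
of the endomorphism `(M - sE)(M^{*ω} - sE)` of the symplectic vector space `V ⊗ K(s)` over the field
`K(s)` of rational functions. It is a polynomial in `t` (the variable of `Polynomial`), with
coefficients in `K(s)`; `RatFunc.X` is `s`. -/
noncomputable def IsSymplectic.charPoly [FiniteDimensional K V] {ω : LinearMap.BilinForm K V}
    (hω : IsSymplectic ω) (M : Module.End K V) : Polynomial (RatFunc K) :=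
  (hω.baseChange (RatFunc K)).psi
    ((LinearMap.baseChange (RatFunc K) M - (RatFunc.X : RatFunc K) • 1) *
      (LinearMap.baseChange (RatFunc K) (hω.adjoint M) - (RatFunc.X : RatFunc K) • 1))

end Field

end SymplecticCharPoly

/-!
Write `N` for the symplectic adjoint of `M`. Since the square of the Pfaffian of an alternating
matrix is its determinant (`pfaffian_sq`), and a symplectic basis has a Gram matrix of determinant
`1`, a scalar `t` is a root of `ψ_A` exactly if `A - t` is singular
(`IsSymplectic.eval_psi_eq_zero_iff`). For `A = (M - s)(N - s)` and `t = (l - s)(m - s)` the terms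
in `s²` cancel, and `A - t = P - sQ` with `P = MN - lm` and `Q = M + N - (l + m)`. So the condition
on the left says that the linear pencil `P - sQ` is singular.

For commuting `P` and `Q` the pencil `P - sQ` is singular exactly if `P` and `Q` have a common
kernel vector (`det_pencil_eq_zero_iff`): the coefficients `v₀, v₁, …` of a polynomial vector in its
kernel satisfy `P v₀ = 0` and `P vₖ₊₁ = Q vₖ`, so each `vₖ` is killed by a power of `P`, and the
leading coefficient is killed by `Q`.

A common kernel vector `v` of `P` and `Q` satisfies `(M - l)(M - m)v = 0` and
`Nv = (l + m)v - Mv`. Either `(M - m)v ≠ 0` is a joint eigenvector for the eigenvalues `(l, m)` of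
`(M, N)`, or `v` is one for `(m, l)`. In the second case the criterion for singular pencils is used
again: the pencil of `M - m` and `N - l` is singular, hence so is the pencil of the adjoints `N - m`
and `M - l`, which has the same determinant (`IsSymplectic.pencilDet_adjoint`).

The identity for the Pfaffian is proved over fields of characteristic zero by comparing the
Pfaffian with the sum over all permutations (`pfaffianSum_eq`), which is easily seen to be
multiplied by `det B` under a congruence `A ↦ B A Bᵀ`. It is transferred to all commutative rings by
specializing the generic alternating matrix over `ℤ`.
-/

namespace SymplecticCharPoly

/-! ### The Pfaffian as a sum over all permutations -/

section Pfaffian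

variable {R : Type*} [CommRing R] {n : ℕ}

/-- The sum of the terms of the Pfaffian over all permutations, instead of only those in standard
form. -/
def pfaffianSum (A : Matrix (Fin n × Fin 2) (Fin n × Fin 2) R) : R :=
  ∑ σ : Equiv.Perm (Fin n × Fin 2),
    ((Equiv.Perm.sign σ : ℤ) : R) * ∏ i, A (σ (i, 0)) (σ (i, 1))

/-- The argument is that for the multiplicativity of the determinant: after expansion, the terms are
indexed by maps `f` of the index set to itself, those of a map `f` add up to a multiple of the
determinant of `B` with its columns rearranged by `f`, and only bijective `f` contribute. -/
theorem pfaffianSum_congr (A B : Matrix (Fin n × Fin 2) (Fin n × Fin 2) R) :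
    pfaffianSum (B * A * B.transpose) = B.det * pfaffianSum A := by
  have key : ∀ σ : Equiv.Perm (Fin n × Fin 2),
      ∏ i, (B * A * B.transpose) (σ (i, 0)) (σ (i, 1)) =
        ∑ f : Fin n × Fin 2 → Fin n × Fin 2,
          (∏ i, A (f (i, 0)) (f (i, 1))) * ∏ p, B (σ p) (f p) := by
    intro σ
    have h : ∀ i, (B * A * B.transpose) (σ (i, 0)) (σ (i, 1)) =
        ∑ g : Fin 2 → Fin n × Fin 2,
          A (g 0) (g 1) * (B (σ (i, 0)) (g 0) * B (σ (i, 1)) (g 1)) := by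
      intro i
      rw [← (finTwoArrowEquiv (Fin n × Fin 2)).symm.sum_comp, Fintype.sum_prod_type_right]
      simp only [Matrix.mul_apply, Matrix.transpose_apply, Finset.sum_mul]
      refine Finset.sum_congr rfl fun a _ => Finset.sum_congr rfl fun c _ => ?_
      simp only [finTwoArrowEquiv_symm_apply, Matrix.cons_val_zero, Matrix.cons_val_one]
      ring
    simp only [h]
    rw [Finset.prod_univ_sum, Fintype.piFinset_univ,
      ← (Equiv.curry (Fin n) (Fin 2) (Fin n × Fin 2)).sum_comp]
    refine Finset.sum_congr rfl fun f _ => ?_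
    simp [Finset.prod_mul_distrib, Fintype.prod_prod_type, Function.curry]
  have hdet : ∀ f : Fin n × Fin 2 → Fin n × Fin 2,
      ∑ σ : Equiv.Perm (Fin n × Fin 2), ((Equiv.Perm.sign σ : ℤ) : R) * ∏ p, B (σ p) (f p) =
        (B.submatrix id f).det := by
    intro f
    simp [Matrix.det_apply']
  simp only [pfaffianSum, key, Finset.mul_sum]
  rw [Finset.sum_comm]
  symm
  refine Fintype.sum_of_injective (fun σ : Equiv.Perm (Fin n × Fin 2) => ⇑σ)
    DFunLike.coe_injective _ _ (fun f hf => ?_) fun σ => ?_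
  · have hf' : ¬ Function.Injective f := fun h =>
      hf ⟨Equiv.ofBijective f (Finite.injective_iff_bijective.1 h), rfl⟩
    simp only [Function.Injective, not_forall] at hf'
    obtain ⟨a, c, hac, hne⟩ := hf'
    simp only [mul_left_comm _ (∏ i, A (f (i, 0)) (f (i, 1)))]
    rw [← Finset.mul_sum, hdet, Matrix.det_zero_of_column_eq hne, mul_zero]
    simp [hac]
  · simp only [mul_left_comm _ (∏ i, A (σ (i, 0)) (σ (i, 1)))]
    rw [← Finset.mul_sum, hdet, Matrix.det_permute']
    ring

theorem sign_prodShear (τ : Equiv.Perm (Fin n)) (ε : Fin n → Equiv.Perm (Fin 2)) :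
    Equiv.Perm.sign (Equiv.prodShear τ ε) = ∏ i, Equiv.Perm.sign (ε i) := by
  have h : Equiv.prodShear τ ε =
      (Equiv.prodCongrLeft fun _ : Fin 2 => τ) * Equiv.prodCongrRight ε := by
    ext ⟨i, k⟩ <;> simp
  rw [h, Equiv.Perm.sign_mul, Equiv.Perm.sign_prodCongrLeft, Equiv.Perm.sign_prodCongrRight]
  simp

theorem perm_fin_two_eq (e : Equiv.Perm (Fin 2)) : e = 1 ∨ e = Equiv.swap 0 1 := by
  revert e; decide

/-- For a skew-symmetric matrix, the term of `σ` in the Pfaffian depends only on the matching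
`{σ(i,0), σ(i,1)}`: it does not change if the pairs are permuted by `τ` and the elements of each
pair by `ε`. -/
theorem term_mul_prodShear {A : Matrix (Fin n × Fin 2) (Fin n × Fin 2) R}
    (hA : ∀ i j, A i j = -A j i) (σ : Equiv.Perm (Fin n × Fin 2)) (τ : Equiv.Perm (Fin n))
    (ε : Fin n → Equiv.Perm (Fin 2)) :
    ((Equiv.Perm.sign (σ * Equiv.prodShear τ ε) : ℤ) : R) *
        ∏ i, A ((σ * Equiv.prodShear τ ε) (i, 0)) ((σ * Equiv.prodShear τ ε) (i, 1)) =
      ((Equiv.Perm.sign σ : ℤ) : R) * ∏ i, A (σ (i, 0)) (σ (i, 1)) := by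
  have h : ∀ i, A ((σ * Equiv.prodShear τ ε) (i, 0)) ((σ * Equiv.prodShear τ ε) (i, 1)) =
      ((Equiv.Perm.sign (ε i) : ℤ) : R) * A (σ (τ i, 0)) (σ (τ i, 1)) := by
    intro i
    rcases perm_fin_two_eq (ε i) with h | h
    · simp [h]
    · simp [h, hA (σ (τ i, 1))]
  simp only [h]
  rw [Finset.prod_mul_distrib, Equiv.Perm.sign_mul, sign_prodShear,
    Equiv.prod_comp τ fun i => A (σ (i, 0)) (σ (i, 1))]
  have hs : (∏ i, ((Equiv.Perm.sign (ε i) : ℤ) : R)) * ∏ i, ((Equiv.Perm.sign (ε i) : ℤ) : R) = 1 := by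
    rw [← Finset.prod_mul_distrib]
    refine Finset.prod_eq_one fun i _ => ?_
    rcases Int.units_eq_one_or (Equiv.Perm.sign (ε i)) with h | h <;> simp [h]
  push_cast
  linear_combination (((Equiv.Perm.sign σ : ℤ) : R) * ∏ i, A (σ (i, 0)) (σ (i, 1))) * hs

/-- A permutation `σ` is standard if it is the standard form of the matching `{σ(i,0), σ(i,1)}`,
that is, one of the permutations that `pfaffian` sums over. -/
def IsStandard (σ : Equiv.Perm (Fin n × Fin 2)) : Prop :=
  (∀ i, toLex (σ (i, 0)) < toLex (σ (i, 1))) ∧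
    ∀ i j, i < j → toLex (σ (i, 0)) < toLex (σ (j, 0))

instance : DecidablePred (IsStandard (n := n)) := fun σ => by
  unfold IsStandard; infer_instance

theorem exists_isStandard_mul (σ : Equiv.Perm (Fin n × Fin 2)) :
    ∃ (τ : Equiv.Perm (Fin n)) (ε : Fin n → Equiv.Perm (Fin 2)),
      IsStandard (σ * Equiv.prodShear τ ε) := by
  have hne : ∀ i, toLex (σ (i, 0)) ≠ toLex (σ (i, 1)) := by
    intro i h
    simpa using σ.injective (toLex.injective h)
  have h : ∀ i, ∃ e : Equiv.Perm (Fin 2), toLex (σ (i, e 0)) < toLex (σ (i, e 1)) := by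
    intro i
    rcases lt_or_gt_of_ne (hne i) with h | h
    · exact ⟨1, h⟩
    · exact ⟨Equiv.swap 0 1, by simpa using h⟩
  choose e he using h
  set m : Fin n → Lex (Fin n × Fin 2) := fun i => toLex (σ (i, e i 0)) with hm
  have hinj : Function.Injective m := by
    intro i j hij
    have := σ.injective (toLex.injective hij)
    exact (Prod.ext_iff.1 this).1
  refine ⟨Tuple.sort m, fun i => e (Tuple.sort m i), fun i => ?_, fun i j hij => ?_⟩
  · simpa using he (Tuple.sort m i)
  · have := (Tuple.monotone_sort m).strictMono_of_injective
      (hinj.comp (Tuple.sort m).injective) hij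
    simpa [hm] using this

/-- Two standard permutations that describe the same matching are equal. -/
theorem IsStandard.eq_one {σ : Equiv.Perm (Fin n × Fin 2)} (hσ : IsStandard σ)
    {τ : Equiv.Perm (Fin n)} {ε : Fin n → Equiv.Perm (Fin 2)}
    (h : IsStandard (σ * Equiv.prodShear τ ε)) : τ = 1 ∧ ε = 1 := by
  have hε : ε = 1 := by
    funext i
    rcases perm_fin_two_eq (ε i) with h1 | h1
    · exact h1
    · have h2 := h.1 i
      simp [h1] at h2
      exact absurd (hσ.1 (τ i)) h2.asymm
  refine ⟨?_, hε⟩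
  subst hε
  have h0 : StrictMono fun i => toLex (σ (i, 0)) := fun i j => hσ.2 i j
  have h1 : StrictMono fun i => toLex (σ (τ i, 0)) := fun i j hij => by
    simpa using h.2 i j hij
  have h2 := (h1.range_inj h0).1 (τ.surjective.range_comp fun i => toLex (σ (i, 0)))
  ext1 i
  exact h0.injective (congrFun h2 i)

theorem prodShear_mul_symm (τ : Equiv.Perm (Fin n)) (ε : Fin n → Equiv.Perm (Fin 2)) :
    Equiv.prodShear τ ε * Equiv.prodShear τ⁻¹ (fun i => (ε (τ⁻¹ i))⁻¹) = 1 := by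
  ext ⟨i, k⟩ <;> simp

theorem prodShear_mul (τ τ' : Equiv.Perm (Fin n)) (ε ε' : Fin n → Equiv.Perm (Fin 2)) :
    Equiv.prodShear τ ε * Equiv.prodShear τ' ε' =
      Equiv.prodShear (τ * τ') (fun i => ε (τ' i) * ε' i) := by
  ext ⟨i, k⟩ <;> simp

/-- The standard permutations are representatives of the cosets of the group of all
`Equiv.prodShear τ ε`, the stabilizer of the matching `{(i,0), (i,1)}`. -/
theorem bijective_standard_mul_prodShear :
    Function.Bijective fun x : (Equiv.Perm (Fin n) × (Fin n → Equiv.Perm (Fin 2))) ×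
        {σ : Equiv.Perm (Fin n × Fin 2) // IsStandard σ} =>
      x.2.1 * Equiv.prodShear x.1.1 x.1.2 := by
  constructor
  · rintro ⟨⟨τ, ε⟩, σ, hσ⟩ ⟨⟨τ', ε'⟩, σ', hσ'⟩ h
    simp only at h
    have h1 : σ' = σ * Equiv.prodShear (τ * τ'⁻¹) (fun i => ε (τ'⁻¹ i) * (ε' (τ'⁻¹ i))⁻¹) := by
      rw [← prodShear_mul τ τ'⁻¹ ε fun i => (ε' (τ'⁻¹ i))⁻¹, ← mul_assoc, h, mul_assoc,
        prodShear_mul_symm, mul_one]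
    obtain ⟨h2, h3⟩ := hσ.eq_one (h1 ▸ hσ')
    have hτ : τ = τ' := mul_inv_eq_one.1 h2
    have hε : ε = ε' := by
      funext i
      simpa [mul_inv_eq_one] using congrFun h3 (τ' i)
    subst hτ hε
    simpa using h
  · intro σ
    obtain ⟨τ, ε, h⟩ := exists_isStandard_mul σ
    refine ⟨⟨⟨τ⁻¹, fun i => (ε (τ⁻¹ i))⁻¹⟩, ⟨_, h⟩⟩, ?_⟩
    simp only
    rw [mul_assoc, prodShear_mul_symm, mul_one]

/-- Each term of the Pfaffian occurs `2 ^ n * n!` times in the sum over all permutations. -/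
theorem pfaffianSum_eq {A : Matrix (Fin n × Fin 2) (Fin n × Fin 2) R}
    (hA : ∀ i j, A i j = -A j i) :
    pfaffianSum A =
      (Fintype.card (Equiv.Perm (Fin n) × (Fin n → Equiv.Perm (Fin 2))) : R) * pfaffian A := by
  rw [pfaffianSum, ← (Equiv.ofBijective _ bijective_standard_mul_prodShear).sum_comp,
    Fintype.sum_prod_type]
  simp only [Equiv.ofBijective_apply, term_mul_prodShear hA]
  rw [Finset.sum_const, Finset.card_univ, nsmul_eq_mul, pfaffian]
  congr 1
  exact (Finset.sum_subtype _ (p := IsStandard) (fun σ => by simp [IsStandard])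
    fun σ => ((Equiv.Perm.sign σ : ℤ) : R) * ∏ i, A (σ (i, 0)) (σ (i, 1))).symm

theorem map_pfaffian {S : Type*} [CommRing S] (φ : R →+* S)
    (A : Matrix (Fin n × Fin 2) (Fin n × Fin 2) R) :
    φ (pfaffian A) = pfaffian (A.map φ) := by
  simp [pfaffian]

end Pfaffian

/-! ### The square of the Pfaffian -/

section PfaffianSquare

/-- The Gram matrix of a symplectic basis `e₁, f₁, …, eₙ, fₙ`: block diagonal with blocks
`!![0, 1; -1, 0]`. -/
def stdSymplectic (n : ℕ) (R : Type*) [CommRing R] : Matrix (Fin n × Fin 2) (Fin n × Fin 2) R :=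
  Matrix.kronecker 1 !![0, 1; -1, 0]

theorem stdSymplectic_apply {R : Type*} [CommRing R] {n : ℕ} (p q : Fin n × Fin 2) :
    stdSymplectic n R p q =
      if p.1 = q.1 then (!![0, 1; -1, 0] : Matrix (Fin 2) (Fin 2) R) p.2 q.2 else 0 := by
  simp [stdSymplectic, Matrix.kroneckerMap_apply, Matrix.one_apply]

theorem det_stdSymplectic {R : Type*} [CommRing R] {n : ℕ} : (stdSymplectic n R).det = 1 := by
  rw [stdSymplectic, Matrix.kronecker, Matrix.det_kronecker]
  simp [Matrix.det_fin_two]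

/-- Only the matching `{(i,0), (i,1)}` contributes to the Pfaffian. -/
theorem pfaffian_stdSymplectic {R : Type*} [CommRing R] {n : ℕ} :
    pfaffian (stdSymplectic n R) = 1 := by
  rw [pfaffian, Finset.sum_eq_single 1]
  · simp [stdSymplectic_apply]
  · intro σ hσ hne
    obtain ⟨h1, h2⟩ := (Finset.mem_filter.1 hσ).2
    by_cases hfst : ∀ i, (σ (i, 0)).1 = (σ (i, 1)).1
    · -- a standard `σ` that preserves the blocks keeps their order as well, so it is the identity
      refine absurd ?_ hne
      have hsnd : ∀ i, (σ (i, 0)).2 = 0 ∧ (σ (i, 1)).2 = 1 := by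
        intro i
        have h := h1 i
        rw [Prod.Lex.toLex_lt_toLex] at h
        have h' := hfst i
        omega
      have hmono : StrictMono fun i => (σ (i, 0)).1 := by
        intro i j hij
        have h := h2 i j hij
        rw [Prod.Lex.toLex_lt_toLex, (hsnd i).1, (hsnd j).1] at h
        simpa using h
      have hid : ∀ i, (σ (i, 0)).1 = i := by
        intro i
        exact congrFun (hmono.range_inj strictMono_id |>.1 (by
          rw [Set.range_id]
          exact (Finite.surjective_of_injective hmono.injective).range_eq)) i
      refine Equiv.ext fun ⟨i, k⟩ => ?_
      fin_cases k
      · exact Prod.ext (hid i) (hsnd i).1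
      · exact Prod.ext ((hfst i).symm.trans (hid i)) (hsnd i).2
    · obtain ⟨i, hi⟩ := not_forall.1 hfst
      rw [Finset.prod_eq_zero (Finset.mem_univ i), mul_zero]
      rw [stdSymplectic_apply, if_neg hi]
  · intro h
    refine absurd (Finset.mem_filter.2 ⟨Finset.mem_univ _, fun i => ?_, fun i j hij => ?_⟩) h <;>
    simp [Prod.Lex.toLex_lt_toLex]
    exact hij

theorem SymplecticBasis.toMatrix_eq {K V : Type*} [Field K] [AddCommGroup V] [Module K V]
    {ω : LinearMap.BilinForm K V} (hω : ω.IsAlt) (b : SymplecticBasis ω) :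
    LinearMap.BilinForm.toMatrix b.basis ω = stdSymplectic b.n K := by
  ext ⟨i, k⟩ ⟨j, l⟩
  rw [LinearMap.BilinForm.toMatrix_apply, stdSymplectic_apply]
  fin_cases k <;> fin_cases l
  · simpa using b.apply_e_e i j
  · simpa using b.apply_e_f i j
  · have h := b.apply_e_f j i
    rw [← hω.neg_eq, neg_eq_iff_eq_neg] at h
    simp only [eq_comm (a := j)] at h
    simp [h, apply_ite]
  · simpa using b.apply_f_f i j

theorem exists_eq_mul_stdSymplectic_mul {K : Type*} [Field K] {n : ℕ}
    {A : Matrix (Fin n × Fin 2) (Fin n × Fin 2) K}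
    (h0 : ∀ i, A i i = 0) (hA : ∀ i j, A i j = -A j i) (hdet : A.det ≠ 0) :
    ∃ B : Matrix (Fin n × Fin 2) (Fin n × Fin 2) K,
      A = B * stdSymplectic n K * B.transpose := by
  have hω : IsSymplectic (Matrix.toBilin' A) := by
    refine ⟨fun v => ?_, LinearMap.BilinForm.nondegenerate_toBilin'_iff_det_ne_zero.2 hdet⟩
    rw [Matrix.toBilin'_apply, ← Finset.sum_product']
    refine Finset.sum_involution (fun p _ => p.swap) (fun p _ => ?_) (fun p _ hp h => hp ?_)
      (fun _ _ => Finset.mem_product.2 ⟨Finset.mem_univ _, Finset.mem_univ _⟩)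
      (fun _ _ => Prod.swap_swap _)
    · simp only [Prod.fst_swap, Prod.snd_swap]
      rw [hA p.1 p.2]
      ring
    · have : p.2 = p.1 := congrArg Prod.fst h
      simp [this, h0]
  obtain ⟨b⟩ := hω.nonempty_symplecticBasis
  have hmat := b.toMatrix_eq hω.alt
  -- the size of the symplectic basis is part of its data and has to be identified with `n`
  obtain ⟨m, b, _, _, _⟩ := b
  simp only at hmat
  obtain rfl : m = n := by
    have h1 := Module.finrank_eq_card_basis b
    simp at h1
    omega
  refine ⟨(b.toMatrix (Pi.basisFun K (Fin m × Fin 2))).transpose, ?_⟩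
  rw [← hmat, Matrix.transpose_transpose, LinearMap.BilinForm.toMatrix_mul_basis_toMatrix,
    LinearMap.BilinForm.toMatrix_basisFun, LinearMap.BilinForm.toMatrix'_toBilin']

/-- Characteristic zero is used to divide by the number `2 ^ n * n!` of `pfaffianSum_eq`. -/
theorem pfaffian_sq_of_charZero {K : Type*} [Field K] [CharZero K] {n : ℕ}
    {A : Matrix (Fin n × Fin 2) (Fin n × Fin 2) K}
    (h0 : ∀ i, A i i = 0) (hA : ∀ i j, A i j = -A j i) (hdet : A.det ≠ 0) :
    pfaffian A ^ 2 = A.det := by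
  obtain ⟨B, hB⟩ := exists_eq_mul_stdSymplectic_mul h0 hA hdet
  have hJ : ∀ i j, stdSymplectic n K i j = -stdSymplectic n K j i := by
    rintro ⟨i, k⟩ ⟨j, l⟩
    simp only [stdSymplectic_apply, eq_comm (a := j)]
    fin_cases k <;> fin_cases l <;> simp [apply_ite]
  have hPf : pfaffian A = B.det := by
    have h := pfaffianSum_congr (stdSymplectic n K) B
    rw [← hB, pfaffianSum_eq hA, pfaffianSum_eq hJ, pfaffian_stdSymplectic, mul_one,
      mul_comm B.det] at h
    refine mul_left_cancel₀ ?_ h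
    exact Nat.cast_ne_zero.2 Fintype.card_ne_zero
  rw [hPf, hB, Matrix.det_mul, Matrix.det_mul, Matrix.det_transpose, det_stdSymplectic]
  ring

/-- The alternating matrix whose entries above the diagonal are independent variables over `ℤ`. The
variables `X (i, j)` with `j ≤ i` are not used. -/
noncomputable def genericAlternating (n : ℕ) : Matrix (Fin n × Fin 2) (Fin n × Fin 2)
    (MvPolynomial ((Fin n × Fin 2) × (Fin n × Fin 2)) ℤ) := fun i j =>
  if toLex i < toLex j then MvPolynomial.X (i, j)
  else if toLex j < toLex i then -MvPolynomial.X (j, i) else 0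

theorem genericAlternating_self {n : ℕ} (i : Fin n × Fin 2) : genericAlternating n i i = 0 := by
  simp [genericAlternating]

theorem genericAlternating_skew {n : ℕ} (i j : Fin n × Fin 2) :
    genericAlternating n i j = -genericAlternating n j i := by
  rcases lt_trichotomy (toLex i) (toLex j) with h | h | h
  · simp [genericAlternating, h, h.not_gt]
  · simp [genericAlternating, h]
  · simp [genericAlternating, h, h.not_gt]

theorem genericAlternating_map {R : Type*} [CommRing R] {n : ℕ}
    {A : Matrix (Fin n × Fin 2) (Fin n × Fin 2) R}
    (h0 : ∀ i, A i i = 0) (hA : ∀ i j, A i j = -A j i) :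
    (genericAlternating n).map
      (MvPolynomial.eval₂Hom (Int.castRingHom R) fun p => A p.1 p.2) = A := by
  ext i j
  rcases lt_trichotomy (toLex i) (toLex j) with h | h | h
  · simp [genericAlternating, h]
  · obtain rfl := toLex.injective h
    simp [genericAlternating, h0]
  · simp [genericAlternating, h, h.not_gt, hA i j]

/-- The square of the Pfaffian of an alternating matrix over any commutative ring is its
determinant. The generic alternating matrix is nonsingular over a field of characteristic zero, and
it specializes to every alternating matrix. -/
theorem pfaffian_sq {R : Type*} [CommRing R] {n : ℕ}
    {A : Matrix (Fin n × Fin 2) (Fin n × Fin 2) R}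
    (h0 : ∀ i, A i i = 0) (hA : ∀ i j, A i j = -A j i) : pfaffian A ^ 2 = A.det := by
  set P := MvPolynomial ((Fin n × Fin 2) × (Fin n × Fin 2)) ℤ
  have hdet : (genericAlternating n).det ≠ 0 := by
    -- the specialization to `stdSymplectic n ℤ` has determinant `1`
    intro h
    have h1 := congrArg (MvPolynomial.eval₂Hom (Int.castRingHom ℤ)
      fun p => stdSymplectic n ℤ p.1 p.2) h
    rw [RingHom.map_det, RingHom.mapMatrix_apply, genericAlternating_map, det_stdSymplectic] at h1
    · simp at h1
    · rintro ⟨i, k⟩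
      fin_cases k <;> simp [stdSymplectic_apply]
    · rintro ⟨i, k⟩ ⟨j, l⟩
      simp only [stdSymplectic_apply, eq_comm (a := j)]
      fin_cases k <;> fin_cases l <;> simp [apply_ite]
  have hgen : pfaffian (genericAlternating n) ^ 2 = (genericAlternating n).det := by
    have hinj : Function.Injective (algebraMap P (FractionRing P)) :=
      IsFractionRing.injective P (FractionRing P)
    apply hinj
    rw [map_pow, map_pfaffian, RingHom.map_det, RingHom.mapMatrix_apply]
    apply pfaffian_sq_of_charZero
    · intro i
      simp [genericAlternating_self]
    · intro i j
      rw [Matrix.map_apply, Matrix.map_apply, genericAlternating_skew i j, map_neg]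
    · rw [← RingHom.mapMatrix_apply, ← RingHom.map_det]
      exact (map_ne_zero_iff _ hinj).2 hdet
  have h := congrArg (MvPolynomial.eval₂Hom (Int.castRingHom R) fun p => A p.1 p.2) hgen
  rwa [map_pow, map_pfaffian, RingHom.map_det, RingHom.mapMatrix_apply,
    genericAlternating_map h0 hA] at h

end PfaffianSquare

/-! ### Singular pencils of commuting endomorphisms -/

section Pencil

open Polynomial

/-- A pencil `A - X B` of commuting matrices over a field is singular exactly if `A` and `B` have a
common kernel vector. -/
theorem det_pencil_eq_zero_iff {F ι : Type*} [Field F] [Fintype ι] [DecidableEq ι]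
    {A B : Matrix ι ι F} (hAB : A * B = B * A) :
    (A.map C - (X : F[X]) • B.map C).det = 0 ↔
      ∃ v, v ≠ 0 ∧ A.mulVec v = 0 ∧ B.mulVec v = 0 := by
  rw [← Matrix.exists_mulVec_eq_zero_iff]
  constructor
  · rintro ⟨v, hv, h⟩
    -- the coefficient vectors of the polynomial vector `v`
    set c : ℕ → ι → F := fun k i => (v i).coeff k with hc
    have hcoeff : ∀ (D : Matrix ι ι F) i k,
        ((D.map C).mulVec v i).coeff k = D.mulVec (c k) i := by
      intro D i k
      simp [Matrix.mulVec, dotProduct, hc, finsetSum_coeff]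
    rw [Matrix.sub_mulVec, Matrix.smul_mulVec, sub_eq_zero] at h
    have h0 : A.mulVec (c 0) = 0 := by
      ext i
      rw [← hcoeff, h]
      simp
    have hs : ∀ k, A.mulVec (c (k + 1)) = B.mulVec (c k) := by
      intro k
      ext i
      rw [← hcoeff, h, ← hcoeff]
      simp
    have hpow : ∀ k, (A ^ (k + 1)).mulVec (c k) = 0 := by
      intro k
      induction k with
      | zero => simpa using h0
      | succ k ih =>
        rw [pow_succ, ← Matrix.mulVec_mulVec, hs, Matrix.mulVec_mulVec,
          ((Commute.pow_left hAB (k + 1) : Commute _ _)).eq, ← Matrix.mulVec_mulVec, ih,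
          Matrix.mulVec_zero]
    -- `c d` is the leading coefficient, or one before a gap
    obtain ⟨d, hd, hd'⟩ : ∃ d, c d ≠ 0 ∧ c (d + 1) = 0 := by
      by_contra! hcon
      obtain ⟨i, hi⟩ := Function.ne_iff.1 hv
      obtain ⟨k, hk⟩ : ∃ k, (v i).coeff k ≠ 0 := by
        by_contra! hz
        exact hi (Polynomial.ext hz)
      have hall : ∀ j, c (k + j) ≠ 0 := by
        intro j
        induction j with
        | zero => exact fun h => hk (congrFun h i)
        | succ j ih => exact hcon _ ih
      refine hall ((Finset.univ.sup fun i => (v i).natDegree) + 1) (funext fun i => ?_)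
      refine coeff_eq_zero_of_natDegree_lt ?_
      have := Finset.le_sup (f := fun i => (v i).natDegree) (Finset.mem_univ i)
      omega
    have hB : B.mulVec (c d) = 0 := by rw [← hs, hd', Matrix.mulVec_zero]
    -- the last nonzero vector among the `A ^ k *ᵥ c d` is a common kernel vector
    classical
    have hex : ∃ k, (A ^ k).mulVec (c d) = 0 := ⟨_, hpow d⟩
    obtain ⟨k, hk⟩ : ∃ k, Nat.find hex = k + 1 := Nat.exists_eq_succ_of_ne_zero fun h0 => by
      have := Nat.find_spec hex
      rw [h0] at this
      exact hd (by simpa using this)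
    refine ⟨(A ^ k).mulVec (c d), Nat.find_min hex (by omega), ?_, ?_⟩
    · rw [Matrix.mulVec_mulVec, ← pow_succ', ← hk]
      exact Nat.find_spec hex
    · rw [Matrix.mulVec_mulVec, ← ((Commute.pow_left hAB k : Commute _ _)).eq,
        ← Matrix.mulVec_mulVec, hB, Matrix.mulVec_zero]
  · rintro ⟨v, hv, hA, hB⟩
    have hmap : ∀ D : Matrix ι ι F, D.mulVec v = 0 → (D.map C).mulVec (fun i => C (v i)) = 0 := by
      intro D hD
      ext1 i
      have h := congrArg C (congrFun hD i)
      simpa [Matrix.mulVec, dotProduct] using h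
    refine ⟨fun i => C (v i), fun h => hv (funext fun i => ?_), ?_⟩
    · simpa using congrFun h i
    · rw [Matrix.sub_mulVec, Matrix.smul_mulVec, hmap A hA, hmap B hB, smul_zero, sub_zero]

variable {F V : Type*} [Field F] [AddCommGroup V] [Module F V] [FiniteDimensional F V]

/-- The determinant of the pencil `P - X Q`, as a polynomial in `X`, computed in the basis
`Module.finBasis F V`. -/
noncomputable def pencilDet (P Q : Module.End F V) : F[X] :=
  ((LinearMap.toMatrix (Module.finBasis F V) (Module.finBasis F V) P).map C -
    (X : F[X]) • (LinearMap.toMatrix (Module.finBasis F V) (Module.finBasis F V) Q).map C).det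

theorem pencilDet_eq_zero_iff {P Q : Module.End F V} (h : P * Q = Q * P) :
    pencilDet P Q = 0 ↔ ∃ v, v ≠ 0 ∧ P v = 0 ∧ Q v = 0 := by
  set b := Module.finBasis F V
  have hcomm : LinearMap.toMatrix b b P * LinearMap.toMatrix b b Q =
      LinearMap.toMatrix b b Q * LinearMap.toMatrix b b P := by
    rw [← LinearMap.toMatrix_mul, h, LinearMap.toMatrix_mul]
  have hker : ∀ (T : Module.End F V) (v : V),
      (LinearMap.toMatrix b b T).mulVec (b.equivFun v) = 0 ↔ T v = 0 := by
    intro T v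
    rw [Module.Basis.equivFun_apply, LinearMap.toMatrix_mulVec_repr,
      ← Module.Basis.equivFun_apply, LinearEquiv.map_eq_zero_iff]
  rw [pencilDet, det_pencil_eq_zero_iff hcomm, b.equivFun.surjective.exists]
  simp only [hker, ne_eq, LinearEquiv.map_eq_zero_iff]

theorem algebraMap_pencilDet (P Q : Module.End F V) :
    algebraMap F[X] (RatFunc F) (pencilDet P Q) =
      LinearMap.det (LinearMap.baseChange (RatFunc F) P -
        (RatFunc.X : RatFunc F) • LinearMap.baseChange (RatFunc F) Q) := by
  rw [pencilDet, RingHom.map_det,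
    ← LinearMap.det_toMatrix (Algebra.TensorProduct.basis (RatFunc F) (Module.finBasis F V))]
  congr 1
  rw [map_sub (LinearMap.toMatrix _ _), map_smul, LinearMap.toMatrix_baseChange,
    LinearMap.toMatrix_baseChange]
  ext i j
  simp [RatFunc.algebraMap_C, RatFunc.algebraMap_X, RatFunc.algebraMap_eq_C, mul_comm RatFunc.X]

end Pencil

/-! ### The symplectic adjoint and the symplectic characteristic polynomial -/

section Adjoint

variable {F V : Type*} [Field F] [AddCommGroup V] [Module F V] [FiniteDimensional F V]
  {ω : LinearMap.BilinForm F V} (hω : IsSymplectic ω)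

theorem IsSymplectic.apply_adjoint (M : Module.End F V) (v w : V) :
    ω v (hω.adjoint M w) = ω (M v) w := by
  have h : ∀ x y, hω.flat x y = ω y x := fun x y => LinearMap.BilinForm.toDual_def _
  rw [← h, adjoint, LinearMap.comp_apply, LinearMap.comp_apply, LinearEquiv.coe_coe,
    LinearEquiv.apply_symm_apply]
  exact h w (M v)

theorem IsSymplectic.adjoint_eq {M N : Module.End F V} (h : ∀ v w, ω v (N w) = ω (M v) w) :
    hω.adjoint M = N := by
  ext w
  rw [← sub_eq_zero]
  refine hω.nondegenerate.2 _ fun v => ?_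
  rw [map_sub, hω.apply_adjoint, h, sub_self]

theorem IsSymplectic.adjoint_adjoint (M : Module.End F V) :
    hω.adjoint (hω.adjoint M) = M :=
  hω.adjoint_eq fun v w => by
    rw [← hω.alt.neg_eq, ← hω.apply_adjoint, hω.alt.neg_eq]

theorem IsSymplectic.adjoint_sub_smul_one (M : Module.End F V) (a : F) :
    hω.adjoint (M - a • 1) = hω.adjoint M - a • 1 :=
  hω.adjoint_eq fun v w => by simp [hω.apply_adjoint]

/-- The matrix of the adjoint of `T` is `J⁻¹ Tᵀ J` with the Gram matrix `J` of `ω`, and a matrix and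
its transpose have the same determinant. -/
theorem IsSymplectic.pencilDet_adjoint (P Q : Module.End F V) :
    pencilDet (hω.adjoint P) (hω.adjoint Q) = pencilDet P Q := by
  set b := Module.finBasis F V with hb
  set J := LinearMap.BilinForm.toMatrix b ω
  have hJ : ∀ T : Module.End F V,
      J * LinearMap.toMatrix b b (hω.adjoint T) = (LinearMap.toMatrix b b T).transpose * J := by
    intro T
    rw [← LinearMap.BilinForm.toMatrix_compRight, ← LinearMap.BilinForm.toMatrix_compLeft]
    congr 1
    ext v w
    exact hω.apply_adjoint T v w
  have hdet : (J.map Polynomial.C).det ≠ 0 := by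
    rw [← RingHom.mapMatrix_apply, ← RingHom.map_det, Polynomial.C_ne_zero]
    exact (LinearMap.BilinForm.nondegenerate_iff_det_ne_zero b).1 hω.nondegenerate
  refine mul_left_cancel₀ hdet ?_
  rw [pencilDet, pencilDet, ← hb, ← Matrix.det_mul, mul_comm,
    ← Matrix.det_transpose (_ - _ : Matrix _ _ (Polynomial F)), ← Matrix.det_mul]
  congr 1
  rw [Matrix.mul_sub, Matrix.mul_smul, ← Matrix.map_mul, ← Matrix.map_mul, hJ, hJ,
    Matrix.map_mul, Matrix.map_mul, Matrix.transpose_sub, Matrix.transpose_smul, Matrix.sub_mul,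
    Matrix.smul_mul, Matrix.transpose_map, Matrix.transpose_map]

/-- The form `(v, w) ↦ ω (v, A w)` of `A = (M - s)(M^{*ω} - s)` is alternating, because
`ω (v, A v) = ω (x, x)` with `x = (M^{*ω} - s) v`. -/
theorem IsSymplectic.baseChange_apply_self (L : Type*) [Field L] [Algebra F L]
    (M : Module.End F V) (s : L) (v : L ⊗[F] V) :
    LinearMap.BilinForm.baseChange L ω v (((LinearMap.baseChange L M - s • 1) *
      (LinearMap.baseChange L (hω.adjoint M) - s • 1)) v) = 0 := by
  have h : ∀ x y, LinearMap.BilinForm.baseChange L ω x (LinearMap.baseChange L M y) =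
      LinearMap.BilinForm.baseChange L ω (LinearMap.baseChange L (hω.adjoint M) x) y := by
    intro x y
    induction x using TensorProduct.induction_on with
    | zero => simp
    | add x x' hx hx' => simp [hx, hx']
    | tmul a v =>
      induction y using TensorProduct.induction_on with
      | zero => simp
      | add y y' hy hy' => simp only [map_add, hy, hy']
      | tmul c w =>
        rw [LinearMap.baseChange_tmul, LinearMap.baseChange_tmul,
          LinearMap.BilinForm.baseChange_tmul, LinearMap.BilinForm.baseChange_tmul,
          ← hω.apply_adjoint, hω.adjoint_adjoint]
  have h' : ∀ x y, LinearMap.BilinForm.baseChange L ω x ((LinearMap.baseChange L M - s • 1) y) =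
      LinearMap.BilinForm.baseChange L ω
        ((LinearMap.baseChange L (hω.adjoint M) - s • 1) x) y := by
    intro x y
    simp [h]
  rw [Module.End.mul_apply, h']
  exact (hω.baseChange L).alt _

/-- The roots of `ψ_A` are the eigenvalues of `A`, because `ψ_A (t) ^ 2 = det (A - t)`. -/
theorem IsSymplectic.eval_psi_eq_zero_iff {A : Module.End F V} (hA : ∀ v, ω v (A v) = 0) (t : F) :
    (hω.psi A).eval t = 0 ↔ LinearMap.det (A - t • 1) = 0 := by
  unfold psi
  set b := Classical.choice hω.nonempty_symplecticBasis
  have halt : (ω.compRight (A - t • 1)).IsAlt := fun v => by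
    have := hω.alt v
    simp_all
  have heval : (b.psi A).eval t =
      pfaffian (LinearMap.BilinForm.toMatrix b.basis (ω.compRight (A - t • 1))) := by
    rw [SymplecticBasis.psi, ← Polynomial.coe_evalRingHom, map_pfaffian]
    congr 1
    ext i j
    simp [LinearMap.BilinForm.toMatrix_apply, mul_comm t]
  have hsq : pfaffian (LinearMap.BilinForm.toMatrix b.basis (ω.compRight (A - t • 1))) ^ 2 =
      LinearMap.det (A - t • 1) := by
    rw [pfaffian_sq, LinearMap.BilinForm.toMatrix_compRight, b.toMatrix_eq hω.alt, Matrix.det_mul,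
      det_stdSymplectic, one_mul, LinearMap.det_toMatrix]
    · intro i
      rw [LinearMap.BilinForm.toMatrix_apply]
      exact halt _
    · intro i j
      rw [LinearMap.BilinForm.toMatrix_apply, LinearMap.BilinForm.toMatrix_apply]
      exact (halt.neg_eq _ _).symm
  rw [heval, ← hsq, sq_eq_zero_iff]

theorem sub_smul_one_mul_sub_smul_one {L A : Type*} [CommRing L] [Ring A] [Algebra L A]
    (x y : A) (a b s : L) :
    (x - s • 1) * (y - s • 1) - ((a - s) * (b - s)) • 1 =
      x * y - (a * b) • 1 - s • (x + y - (a + b) • 1) := by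
  simp only [sub_mul, mul_sub, smul_mul_assoc, mul_smul_comm, one_mul, mul_one]
  module

theorem IsSymplectic.eval_charPoly_eq_zero_iff (M : Module.End F V) (l m : F) :
    (hω.charPoly M).eval ((RatFunc.C l - RatFunc.X) * (RatFunc.C m - RatFunc.X)) = 0 ↔
      pencilDet (M * hω.adjoint M - (l * m) • 1) (M + hω.adjoint M - (l + m) • 1) = 0 := by
  rw [charPoly, eval_psi_eq_zero_iff _ (hω.baseChange_apply_self _ M _),
    ← map_eq_zero_iff _ (RatFunc.algebraMap_injective F), algebraMap_pencilDet]
  have hsmul : ∀ a : F, LinearMap.baseChange (RatFunc F) (a • (1 : Module.End F V)) =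
      RatFunc.C a • 1 := by
    intro a
    rw [LinearMap.baseChange_smul, LinearMap.baseChange_one, ← RatFunc.algebraMap_eq_C,
      algebraMap_smul]
  rw [LinearMap.baseChange_sub, LinearMap.baseChange_sub, LinearMap.baseChange_mul,
    LinearMap.baseChange_add, hsmul, hsmul, map_mul, map_add]
  rw [sub_smul_one_mul_sub_smul_one]

end Adjoint

end SymplecticCharPoly

theorem mainTheorem7 {F : Type*} [Field F] {V : Type*} [AddCommGroup V] [Module F V]
    [FiniteDimensional F V] (ω : LinearMap.BilinForm F V)
    (hω : SymplecticCharPoly.IsSymplectic ω) (M : Module.End F V)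
    (hM : M * hω.adjoint M = hω.adjoint M * M) (l m : F) :
    (hω.charPoly M).eval
        ((RatFunc.C l - RatFunc.X) * (RatFunc.C m - RatFunc.X)) = 0 ↔
      M.eigenspace l ⊓ (hω.adjoint M).eigenspace m ≠ ⊥ := by
  set N := hω.adjoint M with hN
  have hcomm : Commute M N := hM
  have hc : ∀ a : F, Commute M (a • 1) := fun a => (Commute.one_right M).smul_right a
  have hc' : ∀ a : F, Commute N (a • 1) := fun a => (Commute.one_right N).smul_right a
  have h1 : ∀ a b : F, Commute (a • (1 : Module.End F V)) (b • 1) := fun a b =>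
    ((Commute.one_right _).smul_right b).smul_left a
  have hsum : Commute (M * N - (l * m) • 1) (M + N - (l + m) • 1) :=
    (((((Commute.refl M).add_right hcomm).sub_right (hc _)).mul_left
      ((hcomm.symm.add_right (Commute.refl N)).sub_right (hc' _)))).sub_left
      (((hc _).symm.add_right (hc' _).symm).sub_right (h1 _ _))
  have hpair : ∀ a b : F, Commute (M - a • 1) (N - b • 1) := fun a b =>
    (hcomm.sub_right (hc b)).sub_left ((hc' a).symm.sub_right (h1 _ _))
  have hjoint : M.eigenspace l ⊓ N.eigenspace m ≠ ⊥ ↔ ∃ v, v ≠ 0 ∧ M v = l • v ∧ N v = m • v := by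
    rw [Submodule.ne_bot_iff]
    simp only [Submodule.mem_inf, Module.End.mem_eigenspace_iff]
    exact exists_congr fun v => and_comm
  rw [hω.eval_charPoly_eq_zero_iff, SymplecticCharPoly.pencilDet_eq_zero_iff hsum, hjoint]
  simp only [LinearMap.sub_apply, LinearMap.add_apply, LinearMap.smul_apply, Module.End.mul_apply,
    Module.End.one_apply, sub_eq_zero]
  constructor
  · rintro ⟨v, hv, hmul, hadd⟩
    have hNv : N v = (l + m) • v - M v := by rw [← hadd]; abel
    have hMM : M (M v) = (l + m) • M v - (l * m) • v := by
      rw [← hmul, hNv, map_sub, map_smul]; abel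
    by_cases hu : M v = m • v
    · -- `v` is a joint eigenvector for `(m, l)`; passing to the adjoint pencil swaps `l` and `m`
      have hNv' : N v = l • v := by rw [hNv, hu]; module
      have hpen : SymplecticCharPoly.pencilDet (M - m • 1) (N - l • 1) = 0 :=
        (SymplecticCharPoly.pencilDet_eq_zero_iff (hpair m l)).2 ⟨v, hv, by simp [hu], by simp [hNv']⟩
      rw [← hω.pencilDet_adjoint, hω.adjoint_sub_smul_one, hω.adjoint_sub_smul_one,
        hω.adjoint_adjoint, ← hN, SymplecticCharPoly.pencilDet_eq_zero_iff (hpair l m).symm] at hpen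
      obtain ⟨w, hw, hNw, hMw⟩ := hpen
      exact ⟨w, hw, by simpa [sub_eq_zero] using hMw, by simpa [sub_eq_zero] using hNw⟩
    · -- `(M - l)(M - m) v = 0`
      refine ⟨M v - m • v, sub_ne_zero.2 hu, ?_, ?_⟩
      · rw [map_sub, map_smul, hMM]
        module
      · have hNM : N (M v) = (l * m) • v := by
          rw [← hmul]
          exact (LinearMap.congr_fun hM v).symm
        rw [map_sub, map_smul, hNM, hNv]
        module
  · rintro ⟨v, hv, hMv, hNv⟩
    refine ⟨v, hv, ?_, ?_⟩
    · rw [hNv, map_smul, hMv, smul_smul, mul_comm]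
    · rw [hMv, hNv, add_smul]
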